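/- **Theorem 1.4.** For real $p>0$ and $n\in\mathbb{N}$, let $\ell_p^n$ denote $\mathbb{R}^n$ with the distance $\|x-y\|_p=\bigl(\sum_{i=1}^n|x_i-y_i|^p\bigr)^{1/p}$. An $s$-distance set in $\ell_p^n$ is a set $S\subseteq\mathbb{R}^n$ such that the set $\{\|x-y\|_p : x,y\in S,\ x\ne y\}$ has exactly $s$ elements, and $e_s(\ell_p^n)$ denotes the largest cardinality of an $s$-distance set in $\ell_p^n$ (taken to be $0$ if there is none). If $s$ is a positive integer and $p$ is a real number satisfying $2p>s$, then there is a constant $c_{p,s}>0$, depending only on $p$ and $s$, such that for every $n$ $$e_s(\ell_p^n)\le c_{p,s}\,n^{(2ps+2s)/(2p-s)}.$$ In particular, every $s$-distance set in $\ell_p^n$ is finite. -/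

import Mathlib

open scoped ENNReal

/-- The set `{d(x, y) : x, y ∈ S, x ≠ y}` of distances between distinct points of `S`. -/
def distanceSet {X : Type*} [Dist X] (S : Set X) : Set ℝ :=
  {r : ℝ | ∃ x ∈ S, ∃ y ∈ S, x ≠ y ∧ dist x y = r}

/-- `S` is an `s`-distance set: the distances between distinct points of `S` take
exactly `s` values. -/
def IsSDistanceSet {X : Type*} [Dist X] (s : ℕ) (S : Set X) : Prop :=
  (distanceSet S).encard = s

/-- `e_s(X)`: the largest number of points of an `s`-distance set in `X`
(equal to `⊤` if these sets may be infinite or arbitrarily large). -/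
noncomputable def maxSDistance (s : ℕ) (X : Type*) [Dist X] : ℕ∞ :=
  ⨆ (S : Set X) (_ : IsSDistanceSet s S), S.encard

/-- The space `ℓ_p^n`: `ℝⁿ` with `dist x y = (∑ i, |x i - y i| ^ p) ^ (1 / p)`, for `p > 0`. -/
abbrev RealLp (p : ℝ) (n : ℕ) : Type :=
  PiLp (ENNReal.ofReal p) (fun _ : Fin n => ℝ)

/-! The bound is a rank argument. Let `A` be the set of `p`-th powers of the distances, `b = max A`,
and suppose the ratios in `A` are bounded. Approximate `|t| ^ p` on `[-1, 1]` by an even polynomial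
`q` of degree at most `2m` with `q(0) = 0` and error `O(m^{-p})`. After scaling by `b^{1/p}`, the
kernel `∏_{a ∈ A} (1 - (b/a) ∑ i, q((x_i - y_i)/b^{1/p}))` is symmetric and equals 1 on the
diagonal. Off the diagonal one factor nearly vanishes, so it is `O(n m^{-p})`. It is a sum of at
most `(4nm)^s` products `f(x) g(y)`. The inequality `(tr M)² ≤ rank M · ∑ M_xy²` then bounds the
number of points by `2(4nm)^s`, provided that `(4nm)^s (n m^{-p})²` is small. Since `s < 2p`, this
holds for `m` of order `n^{(s+2)/(2p-s)}`, which gives the stated exponent.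

If `A` has a large multiplicative gap above some `a`, being at `p`-th power distance at most `a` is
transitive. The points split into clusters that use only the small values, with representatives that
use only the large ones. Induction on the number of values bounds both counts, and their product is
acceptable because the exponent is superadditive in `s`. -/

/-! ### Low-degree approximation of monomials -/

open Polynomial in
/-- Powers are approximated on `[-1, 1]` by polynomials of much smaller degree. -/
theorem exists_polynomial_near_pow (k m : ℕ) (hk : 0 < k) :
    ∃ P : ℝ[X], P.natDegree ≤ m ∧ ∀ y ∈ Set.Icc (-1 : ℝ) 1,
      |y ^ k - P.eval y| ≤ 2 * Real.exp (-((m : ℝ) ^ 2 / (2 * k))) := by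
  -- With `y = cos θ`, `y ^ k` is a binomial average of Chebyshev polynomials. Keeping degrees at
  -- most `m` leaves a binomial tail as error.
  have hcos : ∀ θ : ℝ, Real.cos θ ^ k =
      ∑ j ∈ Finset.range (k + 1), (k.choose j : ℝ) / 2 ^ k *
        Real.cos (((2 * j - k : ℤ) : ℝ) * θ) := by
    intro θ
    have h : ((Real.cos θ ^ k : ℝ) : ℂ) = ((∑ j ∈ Finset.range (k + 1), (k.choose j : ℝ) / 2 ^ k *
        Complex.exp (((2 * j - k : ℤ) : ℝ) * θ * Complex.I))) := by
      push_cast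
      rw [Complex.cos, div_pow, add_pow, Finset.sum_div]
      refine Finset.sum_congr rfl fun j hj => ?_
      have hj' : j ≤ k := Nat.lt_succ_iff.mp (Finset.mem_range.mp hj)
      rw [← Complex.exp_nat_mul, ← Complex.exp_nat_mul, ← Complex.exp_add]
      rw [Nat.cast_sub hj']
      ring_nf
    have h2 := congrArg Complex.re h
    rw [Complex.ofReal_re, Complex.re_sum] at h2
    rw [h2]
    refine Finset.sum_congr rfl fun j _ => ?_
    rw [← Complex.ofReal_mul, Complex.exp_mul_I, ← Complex.ofReal_cos, ← Complex.ofReal_sin]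
    rw [show ((k.choose j : ℝ) : ℂ) / 2 ^ k = (((k.choose j : ℝ) / 2 ^ k : ℝ) : ℂ) by push_cast; rfl]
    rw [Complex.re_ofReal_mul, Complex.add_re, Complex.ofReal_re, Complex.re_ofReal_mul,
      Complex.I_re, mul_zero, add_zero]
  refine ⟨∑ j ∈ (Finset.range (k + 1)).filter (fun j : ℕ => (2 * j - k : ℤ).natAbs ≤ m),
    C ((k.choose j : ℝ) / 2 ^ k) * Polynomial.Chebyshev.T ℝ (2 * j - k), ?_, ?_⟩
  · refine natDegree_sum_le_of_forall_le _ _ fun j hj => ?_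
    refine (natDegree_C_mul_le _ _).trans ?_
    rw [Chebyshev.natDegree_T]
    exact (Finset.mem_filter.mp hj).2
  · intro y hy
    obtain ⟨θ, rfl⟩ : ∃ θ, Real.cos θ = y := ⟨Real.arccos y, Real.cos_arccos hy.1 hy.2⟩
    rw [hcos, eval_finsetSum, ← Finset.sum_filter_add_sum_filter_not (Finset.range (k + 1))
      (fun j : ℕ => (2 * j - k : ℤ).natAbs ≤ m)]
    simp only [eval_mul, eval_C, Chebyshev.T_real_cos]
    rw [add_sub_cancel_left]
    have hk' : (0 : ℝ) < k := by exact_mod_cast hk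
    -- The Chernoff parameter: this value minimises `k l² / 2 - l m`.
    set l : ℝ := m / k with hl
    have hl0 : 0 ≤ l := by positivity
    have hcosh : ∑ j ∈ Finset.range (k + 1), (k.choose j : ℝ) / 2 ^ k *
        (Real.exp (l * (2 * j - k)) + Real.exp (-(l * (2 * j - k)))) = 2 * Real.cosh l ^ k := by
      have h1 : ∀ l : ℝ, ∑ j ∈ Finset.range (k + 1), (k.choose j : ℝ) / 2 ^ k *
          Real.exp (l * (2 * j - k)) = Real.cosh l ^ k := by
        intro l
        rw [Real.cosh_eq, div_pow, add_pow, Finset.sum_div]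
        refine Finset.sum_congr rfl fun j hj => ?_
        have hj' : j ≤ k := Nat.lt_succ_iff.mp (Finset.mem_range.mp hj)
        rw [← Real.exp_nat_mul, ← Real.exp_nat_mul, ← Real.exp_add, Nat.cast_sub hj']
        ring_nf
      simp only [mul_add, Finset.sum_add_distrib]
      have h2 := h1 (-l)
      simp only [neg_mul] at h2
      have h3 := h1 l
      rw [Real.cosh_neg] at h2
      simp only [mul_sub, neg_sub] at h2 h3 ⊢
      rw [h2, h3]; ring
    calc |_| ≤ ∑ j ∈ (Finset.range (k + 1)).filter (fun j : ℕ => ¬ (2 * j - k : ℤ).natAbs ≤ m),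
          (k.choose j : ℝ) / 2 ^ k *
          ((Real.exp (l * (2 * j - k)) + Real.exp (-(l * (2 * j - k)))) * Real.exp (-(l * m))) := by
          refine (Finset.abs_sum_le_sum_abs _ _).trans (Finset.sum_le_sum fun j hj => ?_)
          rw [abs_mul, abs_of_nonneg (by positivity : (0 : ℝ) ≤ (k.choose j : ℝ) / 2 ^ k)]
          refine mul_le_mul_of_nonneg_left ((Real.abs_cos_le_one _).trans ?_) (by positivity)
          have hj2 := (Finset.mem_filter.mp hj).2
          rw [add_mul, ← Real.exp_add, ← Real.exp_add]
          have hcase : (m : ℝ) ≤ 2 * j - k ∨ (m : ℝ) ≤ -(2 * j - k) := by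
            have : (m : ℤ) ≤ 2 * j - k ∨ (m : ℤ) ≤ -(2 * j - k) := by omega
            exact_mod_cast this
          have e1 := Real.exp_pos (l * (2 * j - k) + -(l * m))
          have e2 := Real.exp_pos (-(l * (2 * j - k)) + -(l * m))
          rcases hcase with h | h
          · have := Real.one_le_exp (x := l * (2 * j - k) + -(l * m)) (by nlinarith)
            linarith
          · have := Real.one_le_exp (x := -(l * (2 * j - k)) + -(l * m)) (by nlinarith)
            linarith
      _ ≤ ∑ j ∈ Finset.range (k + 1), (k.choose j : ℝ) / 2 ^ k *
          ((Real.exp (l * (2 * j - k)) + Real.exp (-(l * (2 * j - k)))) * Real.exp (-(l * m))) :=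
          Finset.sum_le_sum_of_subset_of_nonneg (Finset.filter_subset _ _)
            fun _ _ _ => by positivity
      _ = 2 * Real.cosh l ^ k * Real.exp (-(l * m)) := by
          rw [← hcosh, Finset.sum_mul]; simp only [mul_assoc]
      _ ≤ 2 * Real.exp (l ^ 2 / 2) ^ k * Real.exp (-(l * m)) := by
          have := Real.cosh_le_exp_half_sq l
          have := Real.cosh_pos l
          gcongr
      _ = 2 * Real.exp (-((m : ℝ) ^ 2 / (2 * k))) := by
          rw [← Real.exp_nat_mul, mul_assoc, ← Real.exp_add]
          congr 2
          rw [hl]; field_simp; ring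

/-! ### Jackson-type approximation of `|t| ^ p` -/

theorem Ring.choose_succ_mul (a : ℝ) (k : ℕ) :
    Ring.choose a (k + 1) * (k + 1) = Ring.choose a k * (a - k) := by
  have hk : ((k : ℝ) + 1) ≠ 0 := by positivity
  simp only [Ring.choose_eq_smul, descPochhammer_succ_right, Polynomial.smeval_mul,
    Polynomial.smeval_sub, Polynomial.smeval_X, Polynomial.smeval_natCast, Nat.factorial_succ,
    smul_eq_mul, pow_one, pow_zero, nsmul_eq_mul, mul_one]
  push_cast
  field_simp

/-- The binomial coefficients `choose a k` are `O(k ^ (-a - 1))`. -/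
theorem exists_abs_choose_mul_rpow_le (a : ℝ) (ha : 0 < a) :
    ∃ A : ℝ, 0 < A ∧ ∀ k : ℕ, |Ring.choose a k| * (k : ℝ) ^ (a + 1) ≤ A := by
  set f : ℕ → ℝ := fun k => |Ring.choose a k| * (k : ℝ) ^ (a + 1) with hf
  have hf0 : ∀ k, 0 ≤ f k := fun k => by positivity
  -- Past `a`, consecutive coefficients have absolute ratio `1 - (a+1)/(k+1)`, at most
  -- `(k/(k+1))^(a+1)` by Bernoulli.
  have hstep : ∀ k : ℕ, a ≤ k → f (k + 1) ≤ f k := by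
    intro k hk
    have hk1 : (0 : ℝ) < k + 1 := by positivity
    have hk0 : (0 : ℝ) < k := ha.trans_le hk
    have h1 : |Ring.choose a (k + 1)| = |Ring.choose a k| * (1 - (a + 1) / (k + 1)) := by
      have h2 := congrArg abs (Ring.choose_succ_mul a k)
      rw [abs_mul, abs_mul, abs_of_pos hk1, abs_of_nonpos (by linarith : a - k ≤ 0)] at h2
      field_simp
      rw [h2]; ring
    have h3 := one_add_mul_self_le_rpow_one_add (s := -(1 / ((k : ℝ) + 1)))
      (by rw [neg_le_neg_iff, div_le_one hk1]; linarith) (p := a + 1) (by linarith)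
    have h4 : 1 + -(1 / ((k : ℝ) + 1)) = k / (k + 1) := by field_simp; ring
    rw [h4, Real.div_rpow hk0.le hk1.le] at h3
    have h5 : (1 - (a + 1) / (k + 1)) * ((k : ℝ) + 1) ^ (a + 1) ≤ (k : ℝ) ^ (a + 1) := by
      rw [← le_div_iff₀ (by positivity)]
      refine le_trans (le_of_eq ?_) h3
      ring
    simp only [hf]
    rw [h1]
    push_cast
    rw [mul_assoc]
    exact mul_le_mul_of_nonneg_left h5 (abs_nonneg _)
  refine ⟨∑ i ∈ Finset.range (⌈a⌉₊ + 1), f i + 1,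
    add_pos_of_nonneg_of_pos (Finset.sum_nonneg fun i _ => hf0 i) one_pos, fun k => ?_⟩
  have hsmall : ∀ k ≤ ⌈a⌉₊, f k ≤ ∑ i ∈ Finset.range (⌈a⌉₊ + 1), f i := fun k hk =>
    Finset.single_le_sum (fun i _ => hf0 i) (Finset.mem_range.mpr (by omega))
  suffices f k ≤ ∑ i ∈ Finset.range (⌈a⌉₊ + 1), f i by simp only [hf] at this ⊢; linarith
  rcases le_total k ⌈a⌉₊ with h | h
  · exact hsmall k h
  · induction k, h using Nat.le_induction with
    | base => exact hsmall _ le_rfl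
    | succ k hk ih => exact (hstep k ((Nat.le_ceil a).trans (by exact_mod_cast hk))).trans ih

/-- A telescoping form of comparison with the integral of `x^(-(a+1))`. -/
theorem sum_Ioc_rpow_neg_le (a : ℝ) (ha : 0 < a) (M N : ℕ) (hM : 0 < M) (hMN : M ≤ N) :
    ∑ k ∈ Finset.Ioc M N, (k : ℝ) ^ (-(a + 1)) ≤ ((M : ℝ) ^ (-a) - (N : ℝ) ^ (-a)) / a := by
  induction N, hMN using Nat.le_induction with
  | base => simp
  | succ N hN ih =>
    rw [← Finset.insert_Ioc_right_eq_Ioc_add_one hN, Finset.sum_insert (by simp)]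
    have hN0 : (0 : ℝ) < N := by exact_mod_cast hM.trans_le hN
    have hN1 : (0 : ℝ) < N + 1 := by positivity
    have h1 : (1 + a / (N + 1)) * ((N : ℝ) + 1) ^ (-a) ≤ (N : ℝ) ^ (-a) := by
      have h2 : (N : ℝ) ≤ (N + 1) * Real.exp (-(1 / (N + 1))) := by
        have := Real.add_one_le_exp (-(1 / ((N : ℝ) + 1)))
        calc (N : ℝ) = (N + 1) * (-(1 / (N + 1)) + 1) := by field_simp; ring
          _ ≤ _ := by gcongr
      calc (1 + a / (N + 1)) * ((N : ℝ) + 1) ^ (-a)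
          ≤ Real.exp (a / (N + 1)) * ((N : ℝ) + 1) ^ (-a) := by
            gcongr; linarith [Real.add_one_le_exp (a / ((N : ℝ) + 1))]
        _ = ((N + 1) * Real.exp (-(1 / (N + 1)))) ^ (-a) := by
            rw [Real.mul_rpow hN1.le (Real.exp_pos _).le, ← Real.exp_mul, mul_comm]
            congr 2; ring
        _ ≤ (N : ℝ) ^ (-a) := Real.rpow_le_rpow_of_nonpos hN0 h2 (by linarith)
    have h3 : ((N : ℝ) + 1) ^ (-(a + 1)) = ((N : ℝ) + 1) ^ (-a) / (N + 1) := by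
      rw [neg_add, ← sub_eq_add_neg, Real.rpow_sub_one hN1.ne']
    push_cast
    rw [h3]
    have h4 : ((N : ℝ) + 1) ^ (-a) / (N + 1) ≤ ((N : ℝ) ^ (-a) - ((N : ℝ) + 1) ^ (-a)) / a := by
      rw [le_div_iff₀ ha]
      calc _ = (1 + a / (N + 1)) * ((N : ℝ) + 1) ^ (-a) - ((N : ℝ) + 1) ^ (-a) := by ring
        _ ≤ _ := by linarith
    calc _ ≤ ((N : ℝ) ^ (-a) - ((N : ℝ) + 1) ^ (-a)) / a
          + ((M : ℝ) ^ (-a) - (N : ℝ) ^ (-a)) / a := add_le_add h4 ih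
      _ = _ := by ring

/-- Raise `x/b ≤ exp (x/b)` to the power `b`. With `b = a + 1` and `x = M/(2k)`, the resulting power
of `k` cancels the decay of the binomial coefficients. -/
theorem exp_neg_le_mul_rpow_neg (b : ℝ) (hb : 0 < b) (x : ℝ) (hx : 0 < x) :
    Real.exp (-x) ≤ b ^ b * x ^ (-b) := by
  have h1 : x / b ≤ Real.exp (x / b) := by linarith [Real.add_one_le_exp (x / b)]
  have h2 := Real.rpow_le_rpow (by positivity) h1 hb.le
  rw [← Real.exp_mul, div_mul_cancel₀ _ hb.ne', Real.div_rpow hx.le hb.le,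
    div_le_iff₀ (by positivity)] at h2
  rw [Real.exp_neg, Real.rpow_neg hx.le, ← div_eq_mul_inv, le_div_iff₀ (by positivity),
    inv_mul_le_iff₀ (Real.exp_pos _)]
  exact h2

theorem hasSum_choose_mul_pow (a y : ℝ) (h0 : 0 ≤ y) (h1 : y < 1) :
    HasSum (fun k : ℕ => Ring.choose a k * (-y) ^ k) ((1 - y) ^ a) := by
  have h := (Real.one_add_rpow_hasFPowerSeriesOnBall_zero (a := a)).hasSum (y := -y)
    (by simpa [abs_of_nonneg h0, ← ENNReal.ofReal_one, Metric.eball_ofReal] using h1)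
  simpa [sub_eq_add_neg, binomialSeries, FormalMultilinearSeries.coeff_ofScalars, mul_comm] using h

open Polynomial in
/-- Jackson's theorem for `|t| ^ p` on `[-1, 1]`, with an even polynomial vanishing at `0`. -/
theorem exists_polynomial_near_abs_rpow (p : ℝ) (hp : 0 < p) :
    ∃ C : ℝ, 0 < C ∧ ∀ m : ℕ, 0 < m → ∃ q : ℝ[X], q.natDegree ≤ 2 * m ∧ q.eval 0 = 0 ∧
      (∀ t, q.eval (-t) = q.eval t) ∧
      ∀ t ∈ Set.Icc (-1 : ℝ) 1, |q.eval t - |t| ^ p| ≤ C * (m : ℝ) ^ (-p) := by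
  set a := p / 2 with ha'
  have ha : 0 < a := by positivity
  obtain ⟨A, hA, hAk⟩ := exists_abs_choose_mul_rpow_le a ha
  set B : ℝ := A * (2 * ((a + 1) ^ (a + 1) * 2 ^ (a + 1)) + 1 / a) with hB
  have hB0 : 0 < B := by positivity
  refine ⟨2 * B, by positivity, fun m hm => ?_⟩
  have hm' : (0 : ℝ) < m := by exact_mod_cast hm
  choose! P hPdeg hP using fun k (hk : 0 < k) => exists_polynomial_near_pow k m hk
  -- Cut-off of the series of `(1 - y) ^ a`, where `y = 1 - t²`. Each of the first `M` terms costs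
  -- `O(m^{-p}/M)` when `y ^ k` is replaced by `P k`, and the tail is `O(M^{-a}) = O(m^{-p})`.
  set M := m ^ 2 with hM
  have hM0 : 0 < M := by positivity
  set c : ℕ → ℝ := fun k => Ring.choose a k * (-1) ^ k with hc
  have hck : ∀ k : ℕ, 0 < k → |c k| ≤ A * (k : ℝ) ^ (-(a + 1)) := by
    intro k hk
    have hk' : (0 : ℝ) < k := by exact_mod_cast hk
    have : |c k| = |Ring.choose a k| := by simp [hc, abs_mul]
    rw [this, Real.rpow_neg hk'.le, ← div_eq_mul_inv, le_div_iff₀ (by positivity)]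
    exact hAk k
  set Q : ℝ[X] := C (c 0) + ∑ k ∈ Finset.Ioc 0 M, C (c k) * P k with hQ
  have hQdeg : Q.natDegree ≤ m := by
    refine (natDegree_add_le _ _).trans (max_le (by simp) ?_)
    exact natDegree_sum_le_of_forall_le _ _ fun k hk =>
      (natDegree_C_mul_le _ _).trans (hPdeg k (Finset.mem_Ioc.mp hk).1)
  have hMrpow : (M : ℝ) ^ (-a) = (m : ℝ) ^ (-p) := by
    rw [hM]; push_cast
    rw [← Real.rpow_natCast, ← Real.rpow_mul hm'.le]
    congr 1; rw [ha']; push_cast; ring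
  have hlow : ∀ y ∈ Set.Icc (0 : ℝ) 1, ∀ k ∈ Finset.Ioc 0 M,
      |c k * (y ^ k - (P k).eval y)| ≤
        A * (2 * ((a + 1) ^ (a + 1) * 2 ^ (a + 1))) * ((m : ℝ) ^ (-p) / M) := by
    intro y hy k hk
    have hk0 := (Finset.mem_Ioc.mp hk).1
    have hk' : (0 : ℝ) < k := by exact_mod_cast hk0
    have hMR : (0 : ℝ) < M := by exact_mod_cast hM0
    have e1 := hP k hk0 y ⟨by linarith [hy.1], hy.2⟩
    have e2 := exp_neg_le_mul_rpow_neg (a + 1) (by positivity) ((m : ℝ) ^ 2 / (2 * k)) (by positivity)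
    have e3 : (m : ℝ) ^ 2 = M := by rw [hM]; push_cast; rfl
    rw [e3] at e1 e2
    rw [abs_mul]
    calc |c k| * |y ^ k - (P k).eval y|
        ≤ (A * (k : ℝ) ^ (-(a + 1))) *
          (2 * ((a + 1) ^ (a + 1) * ((M : ℝ) / (2 * k)) ^ (-(a + 1)))) := by
          refine mul_le_mul (hck k hk0) (e1.trans ?_) (abs_nonneg _) (by positivity)
          linarith
      _ = A * (2 * ((a + 1) ^ (a + 1) * 2 ^ (a + 1))) * (M : ℝ) ^ (-(a + 1)) := by
          rw [Real.div_rpow hMR.le (by positivity), Real.mul_rpow (by norm_num) hk'.le,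
            Real.rpow_neg (by norm_num : (0 : ℝ) ≤ 2)]
          have : (0 : ℝ) < (k : ℝ) ^ (-(a + 1)) := by positivity
          have : (0 : ℝ) < (2 : ℝ) ^ (a + 1) := by positivity
          field_simp
      _ = _ := by
          rw [neg_add, ← sub_eq_add_neg, Real.rpow_sub_one hMR.ne', hMrpow]
  have hmain : ∀ y : ℝ, 0 ≤ y → y < 1 → |Q.eval y - (1 - y) ^ a| ≤ B * (m : ℝ) ^ (-p) := by
    intro y hy0 hy1
    have hs := (hasSum_choose_mul_pow a y hy0 hy1).tendsto_sum_nat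
    have hs' := (hs.comp (Filter.tendsto_add_atTop_nat 1)).const_sub (Q.eval y) |>.abs
    refine le_of_tendsto hs' (Filter.eventually_atTop.mpr ⟨M, fun N hN => ?_⟩)
    have hsplit : ∑ k ∈ Finset.range (N + 1), Ring.choose a k * (-y) ^ k =
        c 0 + ∑ k ∈ Finset.Ioc 0 M, c k * y ^ k + ∑ k ∈ Finset.Ioc M N, c k * y ^ k := by
      rw [add_assoc, Finset.sum_Ioc_consecutive _ (Nat.zero_le _) hN, Finset.range_eq_Ico,
        Finset.sum_eq_sum_Ico_succ_bot (by omega)]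
      simp only [hc, pow_zero, mul_one]
      congr 1
      refine Finset.sum_congr ?_ fun k _ => by rw [neg_pow]; ring
      ext k; simp only [Finset.mem_Ico, Finset.mem_Ioc]; omega
    simp only [Function.comp_apply]
    rw [hsplit, hQ, eval_add, eval_C, eval_finsetSum]
    simp only [eval_mul, eval_C]
    have hdiff : c 0 + ∑ k ∈ Finset.Ioc 0 M, c k * (P k).eval y -
        (c 0 + ∑ k ∈ Finset.Ioc 0 M, c k * y ^ k + ∑ k ∈ Finset.Ioc M N, c k * y ^ k) =
        -(∑ k ∈ Finset.Ioc 0 M, c k * (y ^ k - (P k).eval y) +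
          ∑ k ∈ Finset.Ioc M N, c k * y ^ k) := by
      simp only [mul_sub, Finset.sum_sub_distrib]; ring
    rw [hdiff, abs_neg]
    refine (abs_add_le _ _).trans ?_
    have h1 : |∑ k ∈ Finset.Ioc 0 M, c k * (y ^ k - (P k).eval y)| ≤
        A * (2 * ((a + 1) ^ (a + 1) * 2 ^ (a + 1))) * (m : ℝ) ^ (-p) := by
      refine (Finset.abs_sum_le_sum_abs _ _).trans
        ((Finset.sum_le_card_nsmul _ _ _ (hlow y ⟨hy0, hy1.le⟩)).trans (le_of_eq ?_))
      have hMR : (M : ℝ) ≠ 0 := by exact_mod_cast hM0.ne'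
      simp only [Nat.card_Ioc, tsub_zero, nsmul_eq_mul]
      field_simp
    have h2 : |∑ k ∈ Finset.Ioc M N, c k * y ^ k| ≤ A * (1 / a) * (m : ℝ) ^ (-p) := by
      calc _ ≤ ∑ k ∈ Finset.Ioc M N, A * (k : ℝ) ^ (-(a + 1)) := by
            refine (Finset.abs_sum_le_sum_abs _ _).trans (Finset.sum_le_sum fun k hk => ?_)
            have hk0 : 0 < k := hM0.trans (Finset.mem_Ioc.mp hk).1
            rw [abs_mul, abs_of_nonneg (pow_nonneg hy0 k)]
            exact (mul_le_of_le_one_right (abs_nonneg _) (pow_le_one₀ hy0 hy1.le)).trans (hck k hk0)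
        _ ≤ A * (((M : ℝ) ^ (-a) - (N : ℝ) ^ (-a)) / a) := by
            rw [← Finset.mul_sum]
            exact mul_le_mul_of_nonneg_left (sum_Ioc_rpow_neg_le a ha M N hM0 hN) hA.le
        _ ≤ A * ((M : ℝ) ^ (-a) / a) := by
            have : (0 : ℝ) ≤ (N : ℝ) ^ (-a) := by positivity
            gcongr; linarith
        _ = _ := by rw [hMrpow]; ring
    calc _ ≤ _ := add_le_add h1 h2
      _ = _ := by rw [hB]; ring
  have hne : ∀ t ∈ Set.Icc (-1 : ℝ) 1, t ≠ 0 →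
      |Q.eval (1 - t ^ 2) - |t| ^ p| ≤ B * (m : ℝ) ^ (-p) := by
    intro t ht h0
    have ht2 : t ^ 2 ≤ 1 := by nlinarith [ht.1, ht.2]
    have := hmain (1 - t ^ 2) (by linarith) (by linarith [pow_pos (abs_pos.mpr h0) 2, sq_abs t])
    rwa [sub_sub_cancel, ← sq_abs, ← Real.rpow_natCast, ← Real.rpow_mul (abs_nonneg t),
      show ((2 : ℕ) : ℝ) * a = p by rw [ha']; push_cast; ring, Real.rpow_natCast, sq_abs] at this
  -- The point `t = 0` is `y = 1`, on the boundary of convergence, and is reached by continuity.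
  have hzero : |Q.eval 1| ≤ B * (m : ℝ) ^ (-p) := by
    have hcont : Continuous fun t : ℝ => |Q.eval (1 - t ^ 2) - |t| ^ p| :=
      ((Q.continuous.comp (by fun_prop)).sub
        (continuous_abs.rpow_const fun _ => Or.inr hp.le)).abs
    have hlim := (hcont.tendsto 0).mono_left (nhdsWithin_le_nhds (s := Set.Ioi 0))
    simp only [abs_zero, Real.zero_rpow hp.ne', ne_eq, OfNat.ofNat_ne_zero, not_false_eq_true,
      zero_pow, sub_zero] at hlim
    refine le_of_tendsto hlim ?_
    filter_upwards [Ioo_mem_nhdsGT (zero_lt_one' ℝ)] with t ht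
    exact hne t ⟨by linarith [ht.1], ht.2.le⟩ ht.1.ne'
  have hev : ∀ t, (Q.comp (1 - X ^ 2) - C (Q.eval 1)).eval t = Q.eval (1 - t ^ 2) - Q.eval 1 := by
    intro t; simp
  -- Subtracting `Q(1)` forces a zero at `0` and at most doubles the error, hence the constant `2 *
  -- B`.
  refine ⟨Q.comp (1 - X ^ 2) - C (Q.eval 1), ?_, by simp, fun t => by simp [hev], fun t ht => ?_⟩
  · rw [natDegree_sub_C]
    refine natDegree_comp_le.trans ?_
    rw [mul_comm 2 m]
    refine Nat.mul_le_mul hQdeg ?_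
    compute_degree
  · rw [hev]
    have hpos : 0 ≤ B * (m : ℝ) ^ (-p) := by positivity
    by_cases h0 : t = 0
    · subst h0
      simp only [ne_eq, OfNat.ofNat_ne_zero, not_false_eq_true, zero_pow, sub_zero, sub_self,
        abs_zero, Real.zero_rpow hp.ne']
      linarith
    · calc _ = |(Q.eval (1 - t ^ 2) - |t| ^ p) - Q.eval 1| := by congr 1; ring
        _ ≤ _ := (abs_sub _ _).trans (by linarith [hne t ht h0])

/-! ### Separable rank of kernels -/

/-- `F` is a sum of at most `r` products of a function of `x` and a function of `y`. -/
def HasSeparableRankLE {α β : Type*} (r : ℕ) (F : α → β → ℝ) : Prop :=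
  ∃ (ι : Type) (_ : Fintype ι) (f : ι → α → ℝ) (g : ι → β → ℝ),
    Fintype.card ι ≤ r ∧ ∀ x y, F x y = ∑ k, f k x * g k y

namespace HasSeparableRankLE

variable {α β : Type*} {F G : α → β → ℝ} {r r' : ℕ}

theorem mono (hF : HasSeparableRankLE r F) (h : r ≤ r') : HasSeparableRankLE r' F := by
  obtain ⟨ι, _, f, g, hc, hfg⟩ := hF
  exact ⟨ι, _, f, g, hc.trans h, hfg⟩

theorem const (c : ℝ) : HasSeparableRankLE 1 (fun (_ : α) (_ : β) => c) :=
  ⟨Unit, inferInstance, fun _ _ => c, fun _ _ => 1, by simp, by simp⟩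

theorem add (hF : HasSeparableRankLE r F) (hG : HasSeparableRankLE r' G) :
    HasSeparableRankLE (r + r') (fun x y => F x y + G x y) := by
  obtain ⟨ι, _, f, g, hc, hfg⟩ := hF
  obtain ⟨κ, _, f', g', hc', hfg'⟩ := hG
  exact ⟨ι ⊕ κ, inferInstance, Sum.elim f f', Sum.elim g g', by simp; omega,
    fun x y => by simp [hfg, hfg']⟩

theorem mul (hF : HasSeparableRankLE r F) (hG : HasSeparableRankLE r' G) :
    HasSeparableRankLE (r * r') (fun x y => F x y * G x y) := by
  obtain ⟨ι, _, f, g, hc, hfg⟩ := hF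
  obtain ⟨κ, _, f', g', hc', hfg'⟩ := hG
  refine ⟨ι × κ, inferInstance, fun k x => f k.1 x * f' k.2 x, fun k y => g k.1 y * g' k.2 y,
    by simpa using Nat.mul_le_mul hc hc', fun x y => ?_⟩
  simp only [hfg, hfg']
  rw [Finset.sum_mul_sum, Fintype.sum_prod_type]
  exact Finset.sum_congr rfl fun i _ => Finset.sum_congr rfl fun j _ => by ring

theorem const_mul (c : ℝ) (hF : HasSeparableRankLE r F) :
    HasSeparableRankLE r (fun x y => c * F x y) := by
  simpa using (const c).mul hF

theorem sum {κ : Type*} (s : Finset κ) {F : κ → α → β → ℝ}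
    (hF : ∀ i ∈ s, HasSeparableRankLE r (F i)) :
    HasSeparableRankLE (s.card * r) (fun x y => ∑ i ∈ s, F i x y) := by
  classical
  induction s using Finset.induction_on with
  | empty => exact ⟨Empty, inferInstance, fun _ _ => 0, fun _ _ => 0, by simp, by simp⟩
  | insert a s ha ih =>
    simp only [Finset.sum_insert ha, Finset.card_insert_of_notMem ha]
    exact ((hF a (by simp)).add (ih fun i hi => hF i (by simp [hi]))).mono (by ring_nf; rfl)

theorem prod {κ : Type*} (s : Finset κ) {F : κ → α → β → ℝ}
    (hF : ∀ i ∈ s, HasSeparableRankLE r (F i)) :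
    HasSeparableRankLE (r ^ s.card) (fun x y => ∏ i ∈ s, F i x y) := by
  classical
  induction s using Finset.induction_on with
  | empty => simpa using const 1
  | insert a s ha ih =>
    simp only [Finset.prod_insert ha, Finset.card_insert_of_notMem ha]
    exact ((hF a (by simp)).mul (ih fun i hi => hF i (by simp [hi]))).mono (by ring_nf; rfl)

open Polynomial in
-- Expanding in powers of `f x` alone, with coefficients depending on `y`, gives one term per power.
theorem eval_sub (q : ℝ[X]) (f : α → ℝ) (g : β → ℝ) :
    HasSeparableRankLE (q.natDegree + 1) (fun x y => q.eval (f x - g y)) := by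
  refine ⟨Fin (q.natDegree + 1), inferInstance, fun k x => f x ^ (k : ℕ),
    fun k y => (q.comp (X - C (g y))).coeff k, by simp, fun x y => ?_⟩
  have h : (q.comp (X - C (g y))).natDegree < q.natDegree + 1 := by
    rw [natDegree_comp, natDegree_X_sub_C, mul_one]; omega
  rw [Fin.sum_univ_eq_sum_range (fun k => f x ^ k * (q.comp (X - C (g y))).coeff k)]
  simp only [mul_comm (f x ^ _)]
  rw [← eval_eq_sum_range' h]
  simp

theorem rank_le {ι : Type*} [Fintype ι] {F : ι → ι → ℝ} (hF : HasSeparableRankLE r F) :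
    (Matrix.of F).rank ≤ r := by
  obtain ⟨κ, _, f, g, hc, hfg⟩ := hF
  have : Matrix.of F = (Matrix.of fun x k => f k x) * (Matrix.of g) := by
    ext x y; simp [Matrix.mul_apply, hfg]
  rw [this]
  exact (Matrix.rank_mul_le_left _ _).trans ((Matrix.rank_le_card_width _).trans hc)

end HasSeparableRankLE

/-! ### Rank of near-identity matrices and choice of the degree -/

/-- Cauchy–Schwarz applied to the nonzero eigenvalues, of which there are `M.rank`. -/
theorem Matrix.sq_trace_le_rank_mul_sum_sq {ι : Type*} [Fintype ι] [DecidableEq ι]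
    (M : Matrix ι ι ℝ) (hM : M.IsHermitian) :
    M.trace ^ 2 ≤ M.rank * ∑ x, ∑ y, M x y ^ 2 := by
  have htr : M.trace = ∑ i, hM.eigenvalues i := by simpa using hM.trace_eq_sum_eigenvalues
  have hsq : ∑ x, ∑ y, M x y ^ 2 = ∑ i, hM.eigenvalues i ^ 2 := by
    have h1 : (M * M).trace = ∑ x, ∑ y, M x y ^ 2 := by
      simp only [Matrix.trace, Matrix.diag_apply, Matrix.mul_apply]
      refine Finset.sum_congr rfl fun x _ => Finset.sum_congr rfl fun y _ => ?_
      have := hM.apply x y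
      simp only [star_trivial] at this
      rw [this, sq]
    rw [← h1]
    conv_lhs => rw [hM.spectral_theorem]
    rw [← map_mul, Unitary.conjStarAlgAut_apply, Matrix.trace_mul_cycle]
    simp [Matrix.diagonal_mul_diagonal, Matrix.trace_diagonal, sq]
  rw [htr, hsq, hM.rank_eq_card_non_zero_eigs, Fintype.card_subtype]
  have h1 : ∑ i, hM.eigenvalues i =
      ∑ i ∈ Finset.univ.filter (fun i => hM.eigenvalues i ≠ 0), hM.eigenvalues i :=
    (Finset.sum_filter_ne_zero _).symm
  rw [h1]
  refine sq_sum_le_card_mul_sum_sq.trans ?_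
  refine mul_le_mul_of_nonneg_left ?_ (by positivity)
  exact Finset.sum_le_sum_of_subset_of_nonneg (Finset.filter_subset _ _) fun _ _ _ => sq_nonneg _

/-- A symmetric matrix that is close to the identity has large rank. -/
theorem card_le_two_mul_of_near_identity {ι : Type*} [Fintype ι] (F : ι → ι → ℝ) (r : ℕ) (e : ℝ)
    (hF : HasSeparableRankLE r F) (hsymm : ∀ x y, F x y = F y x) (hdiag : ∀ x, F x x = 1)
    (hoff : ∀ x y, x ≠ y → |F x y| ≤ e) (he : (r : ℝ) * e ^ 2 ≤ 1 / 2) :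
    (Fintype.card ι : ℝ) ≤ 2 * r := by
  classical
  have hherm : (Matrix.of F).IsHermitian := by
    ext x y; simpa using hsymm y x
  have h := Matrix.sq_trace_le_rank_mul_sum_sq _ hherm
  have htr : (Matrix.of F).trace = Fintype.card ι := by
    simp [Matrix.trace, hdiag]
  set N : ℝ := (Fintype.card ι : ℝ) with hN
  have hN0 : 0 ≤ N := by positivity
  have hsum : ∑ x, ∑ y, (Matrix.of F) x y ^ 2 ≤ N + N ^ 2 * e ^ 2 := by
    have hxy : ∀ x y, (Matrix.of F) x y ^ 2 ≤ (if x = y then 1 else 0) + e ^ 2 := by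
      intro x y
      by_cases hxy : x = y
      · subst hxy; simp [hdiag, sq_nonneg]
      · simpa [hxy] using sq_le_sq' (by linarith [neg_abs_le (F x y), hoff x y hxy])
          ((le_abs_self _).trans (hoff x y hxy))
    calc _ ≤ ∑ x : ι, ∑ y : ι, ((if x = y then (1 : ℝ) else 0) + e ^ 2) :=
          Finset.sum_le_sum fun x _ => Finset.sum_le_sum fun y _ => hxy x y
      _ = _ := by simp [Finset.sum_add_distrib, ← hN]; ring
  rw [htr] at h
  have hr : ((Matrix.of F).rank : ℝ) ≤ r := by exact_mod_cast hF.rank_le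
  have h2 : N ^ 2 ≤ r * (N + N ^ 2 * e ^ 2) :=
    h.trans (mul_le_mul hr hsum (by positivity) (by positivity))
  have h3 : N ^ 2 ≤ r * N + N ^ 2 * (1 / 2) := by nlinarith [sq_nonneg N]
  rcases hN0.eq_or_lt with h0 | h0
  · rw [← h0]; positivity
  · nlinarith

/-- Chooses `m` for the rank argument: the first condition makes rank times squared error small, the
second is the final count. -/
theorem exists_degree_choice (p : ℝ) (s : ℕ) (hs : (s : ℝ) < 2 * p) (D : ℝ) :
    ∃ c : ℝ, 1 ≤ c ∧ ∀ n : ℕ, 0 < n → ∃ m : ℕ, 0 < m ∧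
      (4 * n * m : ℝ) ^ s * (D * (n * (m : ℝ) ^ (-p))) ^ 2 ≤ 1 / 2 ∧
      2 * (4 * n * m : ℝ) ^ s ≤ c * (n : ℝ) ^ ((2 * p * s + 2 * s) / (2 * p - s)) := by
  set g := 2 * p - s with hg
  have hg0 : 0 < g := by linarith
  set W := max 1 (2 * 4 ^ s * D ^ 2) with hW
  have hW1 : 1 ≤ W := le_max_left _ _
  have hW2 : 2 * 4 ^ s * D ^ 2 ≤ W := le_max_right _ _
  have hW0 : 0 < W := by linarith
  refine ⟨2 * 8 ^ s * W ^ (s / g), ?_, fun n hn => ?_⟩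
  · have h1 : (1 : ℝ) ≤ W ^ (s / g) := Real.one_le_rpow hW1 (by positivity)
    have h2 : (1 : ℝ) ≤ 8 ^ s := one_le_pow₀ (by norm_num)
    nlinarith
  have hn1 : (1 : ℝ) ≤ n := by exact_mod_cast hn
  have hn0 : (0 : ℝ) < n := by linarith
  -- Up to constants the first condition reads `n^(s+2) ≤ m^g`. As `z ≥ 1`, rounding up costs at
  -- most a factor 2, which turns `4` into `8`.
  set z := (W * (n : ℝ) ^ (s + 2)) ^ (1 / g) with hz
  have hz1 : 1 ≤ z := Real.one_le_rpow (one_le_mul_of_one_le_of_one_le hW1 (one_le_pow₀ hn1))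
    (by positivity)
  have hz0 : 0 < z := by linarith
  have hzm : z ≤ (⌈z⌉₊ : ℝ) := Nat.le_ceil z
  have hmz : (⌈z⌉₊ : ℝ) ≤ 2 * z := by linarith [Nat.ceil_lt_add_one hz0.le]
  have hm0 : (0 : ℝ) < ⌈z⌉₊ := by linarith
  refine ⟨⌈z⌉₊, Nat.ceil_pos.mpr hz0, ?_, ?_⟩
  · set m : ℝ := (⌈z⌉₊ : ℝ)
    have hzg : z ^ g = W * (n : ℝ) ^ (s + 2) := by
      rw [hz, ← Real.rpow_mul (by positivity), one_div_mul_cancel hg0.ne', Real.rpow_one]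
    have hmg : W * (n : ℝ) ^ (s + 2) ≤ m ^ g := by
      rw [← hzg]; exact Real.rpow_le_rpow hz0.le hzm hg0.le
    have hpow : m ^ s * (m ^ (-p)) ^ 2 = (m ^ g)⁻¹ := by
      rw [← Real.rpow_natCast m s, ← Real.rpow_natCast (m ^ (-p)) 2, ← Real.rpow_mul hm0.le,
        ← Real.rpow_add hm0, ← Real.rpow_neg hm0.le]
      congr 1; rw [hg]; push_cast; ring
    calc (4 * n * m : ℝ) ^ s * (D * (n * m ^ (-p))) ^ 2
        = 4 ^ s * D ^ 2 * (n : ℝ) ^ (s + 2) * (m ^ s * (m ^ (-p)) ^ 2) := by ring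
      _ = 4 ^ s * D ^ 2 * (n : ℝ) ^ (s + 2) / m ^ g := by rw [hpow]; rfl
      _ ≤ 1 / 2 := by
        rw [div_le_iff₀ (by positivity)]
        have : 2 * 4 ^ s * D ^ 2 * (n : ℝ) ^ (s + 2) ≤ W * (n : ℝ) ^ (s + 2) := by gcongr
        linarith
  · calc 2 * (4 * n * (⌈z⌉₊ : ℝ)) ^ s ≤ 2 * (4 * n * (2 * z)) ^ s := by gcongr
      _ = 2 * 8 ^ s * ((n : ℝ) ^ s * z ^ s) := by ring
      _ = _ := by
        rw [mul_assoc _ (W ^ _)]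
        congr 1
        rw [hz, ← Real.rpow_natCast (_ ^ (1 / g)) s, ← Real.rpow_mul (by positivity),
          Real.mul_rpow hW0.le (by positivity), ← Real.rpow_natCast (n : ℝ) (s + 2),
          ← Real.rpow_mul hn0.le, ← Real.rpow_natCast (n : ℝ) s, mul_left_comm,
          ← Real.rpow_add hn0]
        congr 2
        · ring
        · rw [hg] at hg0 ⊢
          push_cast; field_simp; ring

/-! ### Powers of the distance and the bounded-ratio case -/

/-- The `p`-th power `∑ i, |x i - y i| ^ p` of the `ℓ_p` distance. -/
noncomputable def powDist (p : ℝ) {n : ℕ} (x y : Fin n → ℝ) : ℝ :=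
  ∑ i, |x i - y i| ^ p

theorem powDist_comm (p : ℝ) {n : ℕ} (x y : Fin n → ℝ) : powDist p x y = powDist p y x := by
  simp only [powDist, abs_sub_comm]

theorem powDist_nonneg (p : ℝ) {n : ℕ} (x y : Fin n → ℝ) : 0 ≤ powDist p x y :=
  Finset.sum_nonneg fun _ _ => by positivity

theorem powDist_self {p : ℝ} (hp : p ≠ 0) {n : ℕ} (x : Fin n → ℝ) : powDist p x x = 0 := by
  simp [powDist, Real.zero_rpow hp]

theorem powDist_pos {p : ℝ} {n : ℕ} {x y : Fin n → ℝ} (h : x ≠ y) : 0 < powDist p x y := by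
  obtain ⟨i, hi⟩ := Function.ne_iff.mp h
  exact Finset.sum_pos' (fun _ _ => by positivity)
    ⟨i, Finset.mem_univ i, Real.rpow_pos_of_pos (abs_pos.mpr (sub_ne_zero.mpr hi)) p⟩

/-- A substitute for the triangle inequality that also covers `p < 1`. Its constant is the gap size
used to form clusters. -/
theorem powDist_le_mul_max {p : ℝ} (hp : 0 ≤ p) {n : ℕ} (x y z : Fin n → ℝ) :
    powDist p x z ≤ 2 ^ (p + 1) * max (powDist p x y) (powDist p y z) := by
  have h : ∀ i, |x i - z i| ^ p ≤ 2 ^ p * (|x i - y i| ^ p + |y i - z i| ^ p) := by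
    intro i
    have h1 : |x i - z i| ≤ 2 * max |x i - y i| |y i - z i| := by
      have := abs_sub_le (x i) (y i) (z i)
      linarith [le_max_left |x i - y i| |y i - z i|, le_max_right |x i - y i| |y i - z i|]
    have h2 := Real.rpow_le_rpow (abs_nonneg _) h1 hp
    rw [Real.mul_rpow (by norm_num) (by positivity)] at h2
    refine h2.trans (mul_le_mul_of_nonneg_left ?_ (by positivity))
    have e1 : 0 ≤ |x i - y i| ^ p := by positivity
    have e2 : 0 ≤ |y i - z i| ^ p := by positivity
    rcases max_choice |x i - y i| |y i - z i| with h | h <;> rw [h] <;> linarith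
  calc powDist p x z ≤ 2 ^ p * (powDist p x y + powDist p y z) := by
        simp only [powDist]
        rw [← Finset.sum_add_distrib, Finset.mul_sum]
        exact Finset.sum_le_sum fun i _ => h i
    _ ≤ 2 ^ p * (2 * max (powDist p x y) (powDist p y z)) := by
        gcongr
        linarith [le_max_left (powDist p x y) (powDist p y z),
          le_max_right (powDist p x y) (powDist p y z)]
    _ = _ := by rw [Real.rpow_add_one two_ne_zero]; ring

/-- The bound for sets whose distances have bounded ratios. -/
theorem exists_card_le_of_bounded_ratio (p : ℝ) (s : ℕ) (hs0 : 0 < s) (hs : (s : ℝ) < 2 * p)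
    (L : ℝ) (hL : 1 ≤ L) :
    ∃ c : ℝ, 1 ≤ c ∧ ∀ n : ℕ, 0 < n → ∀ A : Finset ℝ, A.card = s → (∀ a ∈ A, 0 < a) →
      (∀ a ∈ A, ∀ b ∈ A, b ≤ L * a) → ∀ T : Finset (Fin n → ℝ),
      (∀ x ∈ T, ∀ y ∈ T, x ≠ y → powDist p x y ∈ A) →
      (T.card : ℝ) ≤ c * (n : ℝ) ^ ((2 * p * s + 2 * s) / (2 * p - s)) := by
  have hp : 0 < p := by linarith [Nat.cast_nonneg (α := ℝ) s]
  obtain ⟨C, hC, hq⟩ := exists_polynomial_near_abs_rpow p hp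
  set B := 1 + 2 * L with hB
  have hB1 : 1 ≤ B := by linarith
  obtain ⟨c, hc, hm⟩ := exists_degree_choice p s hs (B ^ s * C)
  refine ⟨c, hc, fun n hn A hA hA0 hAL T hT => ?_⟩
  obtain ⟨m, hm0, hme, hmc⟩ := hm n hn
  obtain ⟨q, hqdeg, hq0, hqeven, hqapp⟩ := hq m hm0
  refine le_trans ?_ hmc
  have hn1 : (1 : ℝ) ≤ n := by exact_mod_cast hn
  have hm1 : (1 : ℝ) ≤ m := by exact_mod_cast hm0
  set δ := C * (n * (m : ℝ) ^ (-p)) with hδ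
  have hδ0 : 0 ≤ δ := by positivity
  have hBs : 1 ≤ B ^ s := one_le_pow₀ hB1
  rw [mul_assoc (B ^ s) C, ← hδ] at hme
  -- Needed to bound the factors that are not small by `B = 1 + 2L`.
  have hδ1 : δ ≤ 1 := by
    have h1 : (1 : ℝ) ≤ (4 * n * m : ℝ) ^ s := one_le_pow₀ (by nlinarith)
    have h2 : δ ≤ B ^ s * δ := le_mul_of_one_le_left hδ0 hBs
    have h3 : (B ^ s * δ) ^ 2 ≤ (4 * n * m : ℝ) ^ s * (B ^ s * δ) ^ 2 :=
      le_mul_of_one_le_left (sq_nonneg _) h1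
    by_contra! h
    nlinarith
  -- Scaling by the largest distance puts all coordinate differences in `[-1, 1]`.
  obtain ⟨b, hbA, hbmax⟩ : ∃ b ∈ A, ∀ a ∈ A, a ≤ b :=
    A.exists_max_image id (Finset.card_pos.mp (by omega))
  have hb := hA0 b hbA
  set l := b ^ (1 / p) with hl
  have hl0 : 0 < l := by positivity
  have hlp : l ^ p = b := by
    rw [hl, ← Real.rpow_mul hb.le, one_div_mul_cancel hp.ne', Real.rpow_one]
  set F : T → T → ℝ := fun x y =>
    ∏ a ∈ A, (1 + (-(b / a)) * ∑ i, q.eval (x.1 i / l - y.1 i / l)) with hF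
  have hrank : HasSeparableRankLE ((1 + n * (2 * m + 1)) ^ s) F := by
    rw [← hA]
    refine HasSeparableRankLE.prod A fun a _ => (HasSeparableRankLE.const 1).add
      (HasSeparableRankLE.const_mul _ ?_)
    have h := HasSeparableRankLE.sum (r := 2 * m + 1) (Finset.univ : Finset (Fin n))
      (F := fun (i : Fin n) (x y : T) => q.eval (x.1 i / l - y.1 i / l)) fun i _ =>
      (HasSeparableRankLE.eval_sub q (fun x : T => x.1 i / l) (fun y : T => y.1 i / l)).mono
        (by omega)
    simpa using h
  have hsymm : ∀ x y, F x y = F y x := by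
    intro x y
    simp only [hF]
    have hxy : ∀ i, q.eval (x.1 i / l - y.1 i / l) = q.eval (y.1 i / l - x.1 i / l) := fun i => by
      rw [← hqeven, neg_sub]
    simp only [hxy]
  have hdiag : ∀ x, F x x = 1 := by
    intro x; simp [hF, hq0]
  have hoff : ∀ x y, x ≠ y → |F x y| ≤ B ^ s * δ := by
    intro x y hxy
    have hne : x.1 ≠ y.1 := fun h => hxy (Subtype.ext h)
    have hρA := hT x.1 x.2 y.1 y.2 hne
    set ρ := powDist p x.1 y.1 with hρ
    have hρ0 := hA0 ρ hρA
    set S := ∑ i, q.eval (x.1 i / l - y.1 i / l) with hS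
    have happ : |b * S - ρ| ≤ b * δ := by
      have hsum : b * S - ρ = b * ∑ i, (q.eval (x.1 i / l - y.1 i / l) -
          |x.1 i / l - y.1 i / l| ^ p) := by
        have hscale : ρ = b * ∑ i, |x.1 i / l - y.1 i / l| ^ p := by
          rw [hρ, powDist, Finset.mul_sum]
          refine Finset.sum_congr rfl fun i _ => ?_
          rw [← sub_div, abs_div, abs_of_pos hl0, Real.div_rpow (abs_nonneg _) hl0.le, hlp]
          field_simp
        rw [Finset.sum_sub_distrib, mul_sub, ← hS, ← hscale]
      rw [hsum, abs_mul, abs_of_pos hb]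
      refine mul_le_mul_of_nonneg_left ?_ hb.le
      refine (Finset.abs_sum_le_sum_abs _ _).trans ?_
      refine (Finset.sum_le_card_nsmul _ _ (C * (m : ℝ) ^ (-p)) fun i _ => hqapp _ ?_).trans
        (le_of_eq ?_)
      · rw [← sub_div, Set.mem_Icc, ← abs_le, abs_div, abs_of_pos hl0, div_le_one hl0]
        rw [← Real.rpow_le_rpow_iff (abs_nonneg _) hl0.le hp, hlp]
        refine le_trans ?_ (hbmax ρ hρA)
        exact Finset.single_le_sum (f := fun i => |x.1 i - y.1 i| ^ p)
          (fun _ _ => by positivity) (Finset.mem_univ i)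
      · simp [hδ]; ring
    -- Bounded ratios enter here: `b / a ≤ L` limits how far the approximation error is amplified.
    have hfac : ∀ a ∈ A, |1 + (-(b / a)) * S| ≤ |1 - ρ / a| + L * δ := by
      intro a ha
      have ha0 := hA0 a ha
      have e : 1 + (-(b / a)) * S = (1 - ρ / a) - (b * S - ρ) / a := by field_simp; ring
      rw [e]
      refine (abs_sub _ _).trans ?_
      gcongr
      rw [abs_div, abs_of_pos ha0, div_le_iff₀ ha0]
      refine happ.trans ?_
      have := mul_le_mul_of_nonneg_right (hAL a ha b hbA) hδ0
      linarith
    have hfacB : ∀ a ∈ A, |1 + (-(b / a)) * S| ≤ B := by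
      intro a ha
      have ha0 := hA0 a ha
      refine (hfac a ha).trans ?_
      have h1 : ρ / a ≤ L := by rw [div_le_iff₀ ha0]; exact hAL a ha ρ hρA
      have h2 : 0 < ρ / a := by positivity
      have h3 : |1 - ρ / a| ≤ 1 + L := abs_le.mpr ⟨by linarith, by linarith⟩
      nlinarith
    have hfacρ : |1 + (-(b / ρ)) * S| ≤ B * δ := by
      have := hfac ρ hρA
      rw [div_self hρ0.ne', sub_self, abs_zero, zero_add] at this
      refine this.trans (mul_le_mul_of_nonneg_right (by linarith) hδ0)
    simp only [hF]
    rw [Finset.abs_prod, ← Finset.mul_prod_erase A _ hρA]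
    have hcard : (A.erase ρ).card = s - 1 := by rw [Finset.card_erase_of_mem hρA, hA]
    calc _ ≤ (B * δ) * ∏ a ∈ A.erase ρ, B :=
          mul_le_mul hfacρ (Finset.prod_le_prod (fun _ _ => abs_nonneg _)
            fun a ha => hfacB a (Finset.mem_of_mem_erase ha))
            (Finset.prod_nonneg fun _ _ => abs_nonneg _) (by positivity)
      _ = B ^ s * δ := by
          rw [Finset.prod_const, hcard, mul_right_comm, ← pow_succ', Nat.sub_add_cancel hs0]
  have hR : (((1 + n * (2 * m + 1)) ^ s : ℕ) : ℝ) ≤ (4 * n * m : ℝ) ^ s := by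
    push_cast
    gcongr
    nlinarith
  have h := card_le_two_mul_of_near_identity F _ (B ^ s * δ) hrank hsymm hdiag hoff
    ((mul_le_mul_of_nonneg_right hR (sq_nonneg _)).trans hme)
  rw [Fintype.card_coe] at h
  linarith

/-! ### Multiplicative gaps and induction on the number of distances -/

/-- A finite set of positive reals has a multiplicative gap, or bounded ratios. -/
theorem exists_gap_or_bounded_ratio (A : Finset ℝ) (hA : ∀ a ∈ A, 0 < a) (K : ℝ) (hK : 1 ≤ K) :
    (∃ a ∈ A, (∃ b ∈ A, a < b) ∧ ∀ b ∈ A, a < b → K * a < b) ∨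
      ∀ a ∈ A, ∀ b ∈ A, b ≤ K ^ A.card * a := by
  by_cases hgap : ∃ a ∈ A, (∃ b ∈ A, a < b) ∧ ∀ b ∈ A, a < b → K * a < b
  · exact Or.inl hgap
  refine Or.inr fun a ha => ?_
  push Not at hgap
  -- Induction on the position of `b` in `A`: without a gap, each element is at most `K` times its
  -- predecessor.
  have key : ∀ j : ℕ, ∀ b ∈ A, (A.filter (· < b)).card = j → b ≤ K ^ j * a := by
    intro j
    induction j with
    | zero =>
      intro b hb hj
      have := Finset.filter_eq_empty_iff.mp (Finset.card_eq_zero.mp hj) ha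
      simpa using this
    | succ j ih =>
      intro b hb hj
      obtain ⟨b', hb', hmax⟩ := (A.filter (· < b)).exists_max_image id
        (Finset.card_pos.mp (by omega))
      simp only [id, Finset.mem_filter] at hb' hmax
      obtain ⟨d, hd, hbd, hdK⟩ := hgap b' hb'.1 ⟨b, hb, hb'.2⟩
      have hbd' : b ≤ d := by
        by_contra! h
        exact absurd (hmax d ⟨hd, h⟩) (not_le.mpr hbd)
      have hset : A.filter (· < b) = insert b' (A.filter (· < b')) := by
        ext x
        simp only [Finset.mem_filter, Finset.mem_insert]
        constructor
        · rintro ⟨hx, hxb⟩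
          rcases (hmax x ⟨hx, hxb⟩).eq_or_lt with h | h
          · exact Or.inl h
          · exact Or.inr ⟨hx, h⟩
        · rintro (rfl | ⟨hx, hxb⟩)
          · exact hb'
          · exact ⟨hx, hxb.trans hb'.2⟩
      rw [hset, Finset.card_insert_of_notMem (by simp)] at hj
      have := ih b' hb'.1 (by omega)
      calc b ≤ K * b' := hbd'.trans hdK
        _ ≤ K * (K ^ j * a) := by gcongr
        _ = _ := by ring
  intro b hb
  refine (key _ b hb rfl).trans ?_
  have := hA a ha
  gcongr
  exact Finset.filter_subset _ _

/-- The numerators add up exactly, and each denominator is at least `2p - s`. -/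
theorem exponent_superadditive (p : ℝ) (j k s : ℕ) (hjk : j + k = s) (hs : (s : ℝ) < 2 * p) :
    (2 * p * j + 2 * j) / (2 * p - j) + (2 * p * k + 2 * k) / (2 * p - k) ≤
      (2 * p * s + 2 * s) / (2 * p - s) := by
  have hj : (0 : ℝ) ≤ j := by positivity
  have hk : (0 : ℝ) ≤ k := by positivity
  have e : (s : ℝ) = j + k := by rw [← hjk]; push_cast; rfl
  have hp : 0 < p := by linarith
  calc _ ≤ (2 * p * j + 2 * j) / (2 * p - s) + (2 * p * k + 2 * k) / (2 * p - s) := by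
        gcongr <;> linarith
    _ = _ := by rw [e]; ring

/-- Values need only lie in `A`, so the hypothesis passes to subsets. One constant serves all `j ≤
s`, so both parts of a gap are covered by the induction hypothesis. -/
theorem exists_card_le (p : ℝ) (s : ℕ) (hs : (s : ℝ) < 2 * p) :
    ∃ c : ℝ, 1 ≤ c ∧ ∀ j ≤ s, ∀ n : ℕ, 0 < n → ∀ A : Finset ℝ, A.card = j → (∀ a ∈ A, 0 < a) →
      ∀ T : Finset (Fin n → ℝ), (∀ x ∈ T, ∀ y ∈ T, x ≠ y → powDist p x y ∈ A) →
      (T.card : ℝ) ≤ c * (n : ℝ) ^ ((2 * p * j + 2 * j) / (2 * p - j)) := by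
  classical
  have hp : 0 < p := by linarith [Nat.cast_nonneg (α := ℝ) s]
  induction s with
  | zero =>
    refine ⟨1, le_rfl, fun j hj n _ A hA _ T hT => ?_⟩
    obtain rfl : j = 0 := by omega
    have : T.card ≤ 1 := Finset.card_le_one.mpr fun x hx y hy => by
      by_contra h
      simpa [Finset.card_eq_zero.mp hA] using hT x hx y hy h
    simpa using this
  | succ s ih =>
    obtain ⟨c, hc, ih⟩ := ih (by push_cast at hs; linarith)
    set K : ℝ := 2 ^ (p + 1) with hK
    have hK1 : 1 ≤ K := Real.one_le_rpow (by norm_num) (by linarith)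
    obtain ⟨c', hc', hbdd⟩ := exists_card_le_of_bounded_ratio p (s + 1) (by omega) hs
      (K ^ (s + 1)) (one_le_pow₀ hK1)
    have hcc : c ≤ c * c := le_mul_of_one_le_left (by linarith) hc
    refine ⟨max (c * c) c', le_max_of_le_right hc', fun j hj n hn A hA hA0 T hT => ?_⟩
    have hn1 : (1 : ℝ) ≤ n := by exact_mod_cast hn
    rcases hj.lt_or_eq with hj | rfl
    · refine (ih j (by omega) n hn A hA hA0 T hT).trans ?_
      gcongr
      exact hcc.trans (le_max_left _ _)
    rcases exists_gap_or_bounded_ratio A hA0 K hK1 with ⟨a, ha, ⟨b, hb, hab⟩, hgap⟩ | hratio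
    · have hcard := Finset.card_filter_add_card_filter_not (s := A) (· ≤ a)
      have h1 : 0 < (A.filter (· ≤ a)).card := Finset.card_pos.mpr ⟨a, by simp [ha]⟩
      have h2 : 0 < (A.filter (¬ · ≤ a)).card := Finset.card_pos.mpr ⟨b, by simp [hb, hab]⟩
      set j := (A.filter (· ≤ a)).card with hj
      set k := (A.filter (¬ · ≤ a)).card with hk
      have hself : ∀ x : Fin n → ℝ, powDist p x x ≤ a := fun x => by
        rw [powDist_self hp.ne']; exact (hA0 a ha).le
      -- A value above `a` would exceed `K * a`, contradicting the quasi-triangle inequality.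
      have htrans : ∀ x ∈ T, ∀ y z, z ∈ T → powDist p x y ≤ a → powDist p y z ≤ a →
          powDist p x z ≤ a := by
        intro x hx y z hz hxy hyz
        by_cases hxz : x = z
        · rw [hxz]; exact hself z
        by_contra! h
        have e1 := hgap _ (hT x hx z hz hxz) h
        have e2 := powDist_le_mul_max hp.le x y z
        have e3 : K * max (powDist p x y) (powDist p y z) ≤ K * a := by
          gcongr; exact max_le hxy hyz
        linarith
      -- A maximal separated subset serves as the set of cluster representatives.
      obtain ⟨U, hUT, hUsep, hUmax⟩ : ∃ U ⊆ T, (∀ x ∈ U, ∀ y ∈ U, x ≠ y → a < powDist p x y) ∧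
          ∀ x ∈ T, ∃ y ∈ U, powDist p x y ≤ a := by
        obtain ⟨U, hU, hmax⟩ := (T.powerset.filter
          fun U => ∀ x ∈ U, ∀ y ∈ U, x ≠ y → a < powDist p x y).exists_max_image Finset.card
          ⟨∅, by simp⟩
        simp only [Finset.mem_filter, Finset.mem_powerset] at hU hmax
        refine ⟨U, hU.1, hU.2, fun x hx => ?_⟩
        by_contra! h
        have hxU : x ∉ U := fun hxU => absurd (h x hxU) (not_lt.mpr (hself x))
        have := hmax (insert x U) ⟨Finset.insert_subset hx hU.1, fun u hu v hv huv => by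
          rcases Finset.mem_insert.mp hu with rfl | hu' <;>
            rcases Finset.mem_insert.mp hv with rfl | hv'
          · exact absurd rfl huv
          · exact h v hv'
          · rw [powDist_comm]; exact h u hu'
          · exact hU.2 u hu' v hv' huv⟩
        rw [Finset.card_insert_of_notMem hxU] at this
        omega
      have hU : (U.card : ℝ) ≤ c * (n : ℝ) ^ ((2 * p * k + 2 * k) / (2 * p - k)) := by
        refine ih k (by omega) n hn _ hk.symm (fun x hx => hA0 x (Finset.mem_filter.mp hx).1) U
          fun x hx y hy hxy => ?_
        rw [Finset.mem_filter, not_le]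
        exact ⟨hT x (hUT hx) y (hUT hy) hxy, hUsep x hx y hy hxy⟩
      have hfib : ∀ u ∈ U, ((T.filter fun x => powDist p x u ≤ a).card : ℝ) ≤
          c * (n : ℝ) ^ ((2 * p * j + 2 * j) / (2 * p - j)) := by
        intro u hu
        refine ih j (by omega) n hn _ hj.symm (fun x hx => hA0 x (Finset.mem_filter.mp hx).1) _
          fun x hx y hy hxy => ?_
        rw [Finset.mem_filter] at hx hy ⊢
        exact ⟨hT x hx.1 y hy.1 hxy, htrans x hx.1 u y hy.1 hx.2 (powDist_comm p y u ▸ hy.2)⟩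
      have hcover : T ⊆ U.biUnion fun u => T.filter fun x => powDist p x u ≤ a := by
        intro x hx
        obtain ⟨y, hy, hxy⟩ := hUmax x hx
        exact Finset.mem_biUnion.mpr ⟨y, hy, Finset.mem_filter.mpr ⟨hx, hxy⟩⟩
      have hTcard : (T.card : ℝ) ≤ ∑ u ∈ U, ((T.filter fun x => powDist p x u ≤ a).card : ℝ) := by
        exact_mod_cast (Finset.card_le_card hcover).trans Finset.card_biUnion_le
      have hsplit : j + k = s + 1 := by omega
      calc (T.card : ℝ) ≤ U.card * (c * (n : ℝ) ^ ((2 * p * j + 2 * j) / (2 * p - j))) := by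
            refine hTcard.trans ((Finset.sum_le_card_nsmul _ _ _ hfib).trans (le_of_eq ?_))
            rw [nsmul_eq_mul]
        _ ≤ (c * (n : ℝ) ^ ((2 * p * k + 2 * k) / (2 * p - k))) *
            (c * (n : ℝ) ^ ((2 * p * j + 2 * j) / (2 * p - j))) := by gcongr
        _ = c * c * (n : ℝ) ^ ((2 * p * j + 2 * j) / (2 * p - j) +
            (2 * p * k + 2 * k) / (2 * p - k)) := by
            rw [Real.rpow_add (by linarith)]; ring
        _ ≤ _ := by
            gcongr
            · exact le_max_left _ _
            · exact exponent_superadditive p j k (s + 1) hsplit hs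
    · refine (hbdd n hn A hA hA0 (by rwa [hA] at hratio) T hT).trans ?_
      gcongr
      exact le_max_right _ _

/-! ### Passage to `ℓ_p^n` -/

theorem RealLp.dist_eq_powDist_rpow {p : ℝ} (hp : 0 < p) {n : ℕ} (x y : RealLp p n) :
    dist x y = powDist p x.ofLp y.ofLp ^ (1 / p) := by
  rw [PiLp.dist_eq_sum (by rwa [ENNReal.toReal_ofReal hp.le]), ENNReal.toReal_ofReal hp.le]
  rfl

theorem RealLp.dist_rpow {p : ℝ} (hp : 0 < p) {n : ℕ} (x y : RealLp p n) :
    dist x y ^ p = powDist p x.ofLp y.ofLp := by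
  rw [dist_eq_powDist_rpow hp, ← Real.rpow_mul (powDist_nonneg _ _ _), one_div_mul_cancel hp.ne',
    Real.rpow_one]

/-- A larger set, even an infinite one, would contain `N + 1` points. This makes `s`-distance sets
finite. -/
theorem Set.encard_le_of_forall_finset_card_le {α : Type*} {S : Set α} {N : ℕ}
    (h : ∀ T : Finset α, (T : Set α) ⊆ S → T.card ≤ N) : S.encard ≤ N := by
  by_contra! hlt
  obtain ⟨T, hTS, hT⟩ := Set.exists_subset_encard_eq (Order.add_one_le_of_lt hlt)
  have hfin : T.Finite := Set.finite_of_encard_eq_coe (k := N + 1) (by simpa using hT)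
  have := h hfin.toFinset (by simpa using hTS)
  rw [hfin.encard_eq_coe_toFinset_card] at hT
  have : hfin.toFinset.card = N + 1 := by exact_mod_cast hT
  omega

theorem theorem1p4 (s : ℕ) (hs : 0 < s) (p : ℝ) (hp : (s : ℝ) < 2 * p) :
    ∃ c : ℝ, 0 < c ∧ ∀ n : ℕ,
      ((maxSDistance s (RealLp p n) : ℕ∞) : ℝ≥0∞) ≤
        ENNReal.ofReal (c * (n : ℝ) ^ ((2 * p * s + 2 * s) / (2 * p - s))) := by
  classical
  have hp0 : 0 < p := by linarith [Nat.cast_nonneg (α := ℝ) s]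
  obtain ⟨c, hc, h⟩ := exists_card_le p s hp
  refine ⟨c, by linarith, fun n => ?_⟩
  -- In dimension 0 there are no distances, so no `s`-distance set exists and the supremum is 0.
  rcases Nat.eq_zero_or_pos n with rfl | hn
  · have : maxSDistance s (RealLp p 0) = 0 := by
      refine le_antisymm (iSup₂_le fun S hS => ?_) bot_le
      have hempty : distanceSet S = ∅ :=
        Set.eq_empty_of_forall_notMem fun r ⟨x, _, y, _, hxy, _⟩ =>
          hxy (PiLp.ext fun i => i.elim0)
      rw [IsSDistanceSet, hempty, Set.encard_empty] at hS
      exact absurd (by exact_mod_cast hS.symm : s = 0) hs.ne'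
    rw [this]; simp
  set b := c * (n : ℝ) ^ ((2 * p * s + 2 * s) / (2 * p - s)) with hb
  have hb0 : 0 ≤ b := by positivity
  have hle : maxSDistance s (RealLp p n) ≤ (⌊b⌋₊ : ℕ∞) := by
    refine iSup₂_le fun S hS => Set.encard_le_of_forall_finset_card_le fun T hTS => ?_
    have hfin : (distanceSet S).Finite := Set.finite_of_encard_eq_coe hS
    have hDcard : hfin.toFinset.card = s := by
      have := hfin.encard_eq_coe_toFinset_card
      rw [hS] at this
      exact_mod_cast this.symm
    have hmem : ∀ r ∈ hfin.toFinset, 0 < r := by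
      intro r hr
      obtain ⟨x, _, y, _, hxy, rfl⟩ := hfin.mem_toFinset.mp hr
      rw [RealLp.dist_eq_powDist_rpow hp0]
      exact Real.rpow_pos_of_pos (powDist_pos fun e => hxy (PiLp.ext fun i => congrFun e i)) _
    have hinj : Set.InjOn (fun r : ℝ => r ^ p) hfin.toFinset := fun r hr r' hr' e =>
      (Real.rpow_left_inj (hmem r hr).le (hmem r' hr').le hp0.ne').mp e
    have hT := h s le_rfl n hn (hfin.toFinset.image fun r => r ^ p)
      (by rw [Finset.card_image_of_injOn hinj, hDcard])
      (by
        simp only [Finset.forall_mem_image]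
        exact fun r hr => Real.rpow_pos_of_pos (hmem r hr) p)
      (T.image WithLp.ofLp) (by
        simp only [Finset.forall_mem_image]
        intro x hx y hy hxy
        rw [← RealLp.dist_rpow hp0]
        exact Finset.mem_image_of_mem _ (hfin.mem_toFinset.mpr
          ⟨x, hTS hx, y, hTS hy, fun e => hxy (by rw [e]), rfl⟩))
    rw [Finset.card_image_of_injective _ (WithLp.ofLp_injective _)] at hT
    exact Nat.le_floor hT
  calc ((maxSDistance s (RealLp p n) : ℕ∞) : ℝ≥0∞) ≤ ((⌊b⌋₊ : ℕ∞) : ℝ≥0∞) := by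
        exact_mod_cast hle
    _ = ENNReal.ofReal ⌊b⌋₊ := by simp
    _ ≤ ENNReal.ofReal b := ENNReal.ofReal_le_ofReal (Nat.floor_le hb0)
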